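/- Let $\lambda,\epsilon,L>0$ and let $X_1<X_2<\cdots$ be the points (sensors), in increasing order, of a Poisson process of intensity $\lambda$ on $[0,\infty)$, i.e. $X_1,\,X_2-X_1,\,X_3-X_2,\dots$ are independent exponential random variables with parameter $\lambda$. Two sensors at $x$ and $y$ are directly connected if $|x-y|\le\epsilon$; for $i<j$ the sensors $X_i$ and $X_j$ belong to the same cluster if $X_l$ and $X_{l+1}$ are directly connected for every $l=i,\dots,j-1$. Let $\beta_0'(L)$ be the number of clusters having at least one point in $[0,L]$. Define $G(-1)=e^{-\lambda L}$ and, for every integer $k\ge 0$, $$G(k)=(-1)^{k}\left(e^{-k\lambda\epsilon}\sum_{j=0}^{k}\frac{[\lambda(k\epsilon-L)]^{j}}{j!}-e^{-\lambda L}\right)\mathbf 1_{\{L>k\epsilon\}}.$$ Then, for every integer $n\ge 0$, $$\Pr(\beta_0'(L)=n)=\sum_{i=n}^{\lfloor L/\epsilon\rfloor+1}(-1)^{i+n}\binom{i}{n}\bigl(G(i-1)+G(i)\bigr),$$ where an empty sum is $0$. -/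

import Mathlib

open MeasureTheory ProbabilityTheory

/-- Spacings of a sequence `X 0, X 1, …` of positions on the half-line, listed from left to right:
the first one is the distance from the origin to `X 0`, the next ones are the distances
between successive points. -/
def spacing {Ω : Type*} (X : ℕ → Ω → ℝ) : ℕ → Ω → ℝ
  | 0 => X 0
  | i + 1 => fun ω => X (i + 1) ω - X i ω

/-- `X 0 < X 1 < …` are the points of a (homogeneous) Poisson process of intensity `lam` on
`[0, ∞)`: the spacings are independent, exponential random variables with parameter `lam`. -/
structure IsPoissonProcess {Ω : Type*} [MeasurableSpace Ω] (μ : Measure Ω) (lam : ℝ)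
    (X : ℕ → Ω → ℝ) : Prop where
  measurable : ∀ i, Measurable (X i)
  indep : iIndepFun (spacing X) μ
  law : ∀ i, μ.map (spacing X i) = expMeasure lam

/-- Sensors located at `x` and `y` are directly connected if they are within range `ε`. -/
def DirectlyConnected (ε x y : ℝ) : Prop := |x - y| ≤ ε

/-- Sensors number `i` and `j` of the configuration `x 0, x 1, …` (listed from left to right)
belong to the same cluster: all pairs of neighbouring sensors between them
are directly connected. (No condition if `i = j`.) -/
def SameCluster (ε : ℝ) (x : ℕ → ℝ) (i j : ℕ) : Prop :=
  ∀ l, min i j ≤ l → l < max i j → DirectlyConnected ε (x l) (x (l + 1))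

/-- The cluster of the sensor number `i`, as a set of (indices of) sensors. -/
def cluster (ε : ℝ) (x : ℕ → ℝ) (i : ℕ) : Set ℕ := {j | SameCluster ε x i j}

/-- The number of incomplete clusters on `[0, L]`: the number of clusters
having at least one point in `[0, L]`. -/
noncomputable def numIncompleteClusters (ε L : ℝ) (x : ℕ → ℝ) : ℕ∞ :=
  Set.encard {C : Set ℕ | (∃ i, C = cluster ε x i) ∧ ∃ j ∈ C, x j ∈ Set.Icc 0 L}

open Classical in
/-- The function `G`, defined on the integers `k ≥ -1`
(the values at integers below `-1` are irrelevant). -/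
noncomputable def clusterG (lam ε L : ℝ) : ℤ → ℝ
  | Int.ofNat k =>
      if k * ε < L then
        (-1) ^ k * (Real.exp (-(k * lam * ε)) *
            ∑ j ∈ Finset.range (k + 1), (lam * (k * ε - L)) ^ j / (j.factorial : ℝ)
          - Real.exp (-(lam * L)))
      else 0
  | Int.negSucc _ => Real.exp (-(lam * L))

/-!
# The number of clusters of a Poisson process that meet `[0, L]`

Almost surely the positions are positive and strictly increasing. A cluster then meets `[0, L]` iff
its first sensor lies in `[0, L]`, and the first sensors are sensor number `0` and the sensors
preceded by a *long gap*, a spacing exceeding `ε`. Since long gaps in `[0, L]` have total length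
at most `L`, the number `β` of clusters is at most `⌊L / ε⌋ + 1`, so its distribution follows from
its binomial moments `E[C(β, i)]` by binomial inversion (`sum_Icc_alternating_choose_mul_choose`),
and the point is to show that `E[C(β, i)] = G(i - 1) + G(i)`.

To choose `i ≥ 1` clusters, choose the rightmost one first (`choose_succ_numIncompleteClusters`).
This reduces the moments to the expectations of `C(J, k)`, where `J` is the number of long gaps
before sensor number `m`, on the event that the gap after sensor `m` is long and sensor `m + 1`
lies in `[0, L]`. Integrating out one spacing at a time, lack of memory of the exponential law
(`lintegral_expMeasure_indicator_Ioi`) gives for this expectation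
`C(m, k) e^{-(k+1)λε} H (m + 1) (L - (k + 1) ε)`, with `H m` the distribution function of the sum
of `m + 1` spacings (`IsPoissonProcess.lintegral_choose_longGapCount_succ`).

Since `H m a = P(N > m)` for a Poisson variable `N` of mean `λa`, the sum over `m` is the moment
`E[C(N - 1, k + 1); N ≥ 1]` (`tsum_choose_mul_erlangCDF`). By Pascal's rule, two consecutive such
moments add up to a factorial moment of `N`, which yields the truncated exponential series in `G`
(`hasSum_choose_mul_poissonWeight_succ`).
-/

open scoped ENNReal

/-! ### Clusters and their first sensors -/

/-- Sensor number `m` is the first one (in the order of indices) of its cluster: it is sensor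
number `0`, or it is not directly connected to its predecessor. -/
def IsClusterStart (ε : ℝ) (x : ℕ → ℝ) (m : ℕ) : Prop :=
  ∀ l, m = l + 1 → ¬ DirectlyConnected ε (x l) (x (l + 1))

theorem SameCluster.symm {ε : ℝ} {x : ℕ → ℝ} {i j : ℕ} (h : SameCluster ε x i j) :
    SameCluster ε x j i := by
  intro l h1 h2
  exact h l (by rwa [min_comm]) (by rwa [max_comm])

theorem SameCluster.trans {ε : ℝ} {x : ℕ → ℝ} {i j k : ℕ} (h : SameCluster ε x i j)
    (h' : SameCluster ε x j k) : SameCluster ε x i k := by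
  intro l h1 h2
  by_cases hl : min i j ≤ l ∧ l < max i j
  · exact h l hl.1 hl.2
  · exact h' l (by omega) (by omega)

theorem mem_cluster_self (ε : ℝ) (x : ℕ → ℝ) (i : ℕ) : i ∈ cluster ε x i := by
  intro l h1 h2
  omega

theorem cluster_eq_of_sameCluster {ε : ℝ} {x : ℕ → ℝ} {i j : ℕ} (h : SameCluster ε x i j) :
    cluster ε x i = cluster ε x j :=
  Set.ext fun _ => ⟨fun hk => h.symm.trans hk, fun hk => h.trans hk⟩

theorem IsClusterStart.le_of_mem_cluster {ε : ℝ} {x : ℕ → ℝ} {m j : ℕ}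
    (hm : IsClusterStart ε x m) (hj : j ∈ cluster ε x m) : m ≤ j := by
  by_contra! h
  obtain ⟨l, rfl⟩ : ∃ l, m = l + 1 := ⟨m - 1, by omega⟩
  exact hm l rfl (hj l (by omega) (by omega))

theorem exists_isClusterStart (ε : ℝ) (x : ℕ → ℝ) (i : ℕ) :
    ∃ m, IsClusterStart ε x m ∧ cluster ε x i = cluster ε x m := by
  induction i with
  | zero => exact ⟨0, fun l hl => by omega, rfl⟩
  | succ i ih =>
    by_cases h : DirectlyConnected ε (x i) (x (i + 1))
    · obtain ⟨m, hm, he⟩ := ih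
      refine ⟨m, hm, (cluster_eq_of_sameCluster ?_).trans he⟩
      intro l h1 h2
      obtain rfl : l = i := by omega
      exact h
    · refine ⟨i + 1, fun l hl => ?_, rfl⟩
      obtain rfl : i = l := by omega
      exact h

theorem injOn_cluster_isClusterStart (ε : ℝ) (x : ℕ → ℝ) :
    Set.InjOn (cluster ε x) {m | IsClusterStart ε x m} := by
  intro i hi j hj hij
  refine le_antisymm (hi.le_of_mem_cluster ?_) (hj.le_of_mem_cluster ?_)
  · rw [hij]; exact mem_cluster_self ε x j
  · rw [← hij]; exact mem_cluster_self ε x i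

/-- Counting clusters amounts to counting their first sensors. -/
theorem numIncompleteClusters_eq_encard (ε L : ℝ) (x : ℕ → ℝ) :
    numIncompleteClusters ε L x =
      {m | IsClusterStart ε x m ∧ ∃ j ∈ cluster ε x m, x j ∈ Set.Icc 0 L}.encard := by
  have hinj : Set.InjOn (cluster ε x)
      {m | IsClusterStart ε x m ∧ ∃ j ∈ cluster ε x m, x j ∈ Set.Icc 0 L} :=
    (injOn_cluster_isClusterStart ε x).mono fun m hm => hm.1
  rw [numIncompleteClusters, ← hinj.encard_image]
  congr 1
  ext C
  constructor
  · rintro ⟨⟨i, rfl⟩, hC⟩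
    obtain ⟨m, hm, he⟩ := exists_isClusterStart ε x i
    exact ⟨m, ⟨hm, he ▸ hC⟩, he.symm⟩
  · rintro ⟨m, ⟨-, hC⟩, rfl⟩
    exact ⟨⟨m, rfl⟩, hC⟩

/-- A random set of natural numbers has `n` elements iff it is one of the countably many finite
sets with `n` elements. -/
theorem measurableSet_encard_eq {α : Type*} [MeasurableSpace α] {S : α → Set ℕ}
    (hS : ∀ m, MeasurableSet {a | m ∈ S a}) (n : ℕ) :
    MeasurableSet {a | (S a).encard = n} := by
  have : {a | (S a).encard = n} =
      ⋃ t : {t : Finset ℕ // t.card = n}, {a | ∀ m, m ∈ S a ↔ m ∈ t.1} := by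
    ext a
    simp only [Set.mem_ofPred_eq, Set.mem_iUnion, Subtype.exists]
    constructor
    · intro h
      have hf : (S a).Finite := Set.finite_of_encard_eq_coe h
      refine ⟨hf.toFinset, ?_, by simp⟩
      rw [hf.encard_eq_coe_toFinset_card] at h
      exact_mod_cast h
    · rintro ⟨t, ht, h⟩
      rw [show S a = t from Set.ext h, Set.encard_coe_eq_coe_finsetCard, ht]
  rw [this]
  refine MeasurableSet.iUnion fun t => ?_
  rw [Set.ofPred_forall]
  exact MeasurableSet.iInter fun m => (hS m).iff (.const _)

theorem measurableSet_numIncompleteClusters_eq {Ω : Type*} [MeasurableSpace Ω] {X : ℕ → Ω → ℝ}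
    (hX : ∀ i, Measurable (X i)) (ε L : ℝ) (n : ℕ) :
    MeasurableSet {ω | numIncompleteClusters ε L (fun i => X i ω) = (n : ℕ∞)} := by
  have hD : ∀ l, MeasurableSet {ω | DirectlyConnected ε (X l ω) (X (l + 1) ω)} := fun l =>
    measurableSet_le ((hX l).sub (hX (l + 1))).abs measurable_const
  simp_rw [numIncompleteClusters_eq_encard]
  refine measurableSet_encard_eq (fun m => ?_) n
  refine measurableSet_setOfPred.2 (.and ?_ (.exists fun j => .and ?_ ?_))
  · exact .forall fun l => .forall fun _ => (measurableSet_setOfPred.1 (hD l)).not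
  · exact .forall fun l => .forall fun _ => .forall fun _ => measurableSet_setOfPred.1 (hD l)
  · exact measurableSet_setOfPred.1 (hX j measurableSet_Icc)

/-! ### Strictly increasing configurations -/

/-- The first sensors of clusters that lie at or to the left of `L`. -/
def startsUpTo (ε L : ℝ) (x : ℕ → ℝ) : Set ℕ := {m | IsClusterStart ε x m ∧ x m ≤ L}

/-- The number of spacings exceeding `ε` among the first `m` spacings between sensors. -/
noncomputable def longGapCount (ε : ℝ) (x : ℕ → ℝ) (m : ℕ) : ℕ :=
  ∑ l ∈ Finset.range m, if ε < x (l + 1) - x l then 1 else 0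

open Classical in
/-- The number of first sensors of clusters that lie at or to the left of `L` and have an index
less than `m`. -/
noncomputable def startCount (ε L : ℝ) (x : ℕ → ℝ) (m : ℕ) : ℕ :=
  ∑ i ∈ Finset.range m, if i ∈ startsUpTo ε L x then 1 else 0

section StrictMono

variable {ε L : ℝ} {x : ℕ → ℝ}

theorem isClusterStart_zero : IsClusterStart ε x 0 := fun l hl => by omega

theorem isClusterStart_succ_iff (hx : StrictMono x) (m : ℕ) :
    IsClusterStart ε x (m + 1) ↔ ε < x (m + 1) - x m := by
  have h : x m < x (m + 1) := hx (Nat.lt_succ_self m)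
  have key : DirectlyConnected ε (x m) (x (m + 1)) ↔ x (m + 1) - x m ≤ ε := by
    rw [DirectlyConnected, abs_sub_comm, abs_of_pos (by linarith)]
  constructor
  · intro hs
    have := hs m rfl
    rwa [key, not_le] at this
  · intro hs l hl
    obtain rfl : m = l := by omega
    rwa [key, not_le]

theorem numIncompleteClusters_eq_encard_startsUpTo (hx : StrictMono x) (h0 : 0 < x 0) :
    numIncompleteClusters ε L x = (startsUpTo ε L x).encard := by
  rw [numIncompleteClusters_eq_encard]
  congr 1
  ext m
  refine and_congr_right fun hm => ⟨?_, fun h => ?_⟩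
  · rintro ⟨j, hj, hjL⟩
    exact (hx.monotone (hm.le_of_mem_cluster hj)).trans hjL.2
  · exact ⟨m, mem_cluster_self ε x m, h0.le.trans (hx.monotone (Nat.zero_le m)), h⟩

theorem longGapCount_mul_le (hx : StrictMono x) (h0 : 0 < x 0) (m : ℕ) :
    longGapCount ε x m * ε ≤ x m := by
  induction m with
  | zero => simpa [longGapCount] using h0.le
  | succ m ih =>
    have h : x m < x (m + 1) := hx (Nat.lt_succ_self m)
    rw [longGapCount, Finset.sum_range_succ, ← longGapCount]
    split_ifs with hg
    · push_cast; linarith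
    · push_cast; linarith

/-- If sensor number `m` lies at or to the left of `L`, so do all previous ones, hence the first
sensors before it are sensor number `0` and those following a long gap. -/
theorem startCount_succ_eq (hx : StrictMono x) {m : ℕ} (hm : x m ≤ L) :
    startCount ε L x (m + 1) = 1 + longGapCount ε x m := by
  rw [startCount, longGapCount, Finset.sum_range_succ', add_comm]
  congr 1
  · rw [if_pos ⟨isClusterStart_zero, (hx.monotone (Nat.zero_le m)).trans hm⟩]
  · refine Finset.sum_congr rfl fun l hl => ?_
    have hl' : x (l + 1) ≤ L := (hx.monotone (Finset.mem_range.1 hl)).trans hm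
    simp [startsUpTo, isClusterStart_succ_iff hx, hl']

theorem startCount_succ_of_notMem {m : ℕ} (hm : m ∉ startsUpTo ε L x) :
    startCount ε L x (m + 1) = startCount ε L x m := by
  rw [startCount, Finset.sum_range_succ, if_neg hm, add_zero, startCount]

theorem startCount_succ_of_mem {m : ℕ} (hm : m ∈ startsUpTo ε L x) :
    startCount ε L x (m + 1) = startCount ε L x m + 1 := by
  rw [startCount, Finset.sum_range_succ, if_pos hm, startCount]

theorem startCount_le (hε : 0 < ε) (hx : StrictMono x) (h0 : 0 < x 0) (m : ℕ) :
    startCount ε L x m ≤ ⌊L / ε⌋₊ + 1 := by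
  induction m with
  | zero => simp [startCount]
  | succ m ih =>
    by_cases hm : m ∈ startsUpTo ε L x
    · rw [startCount_succ_eq hx hm.2, add_comm]
      gcongr
      refine Nat.le_floor ?_
      rw [le_div_iff₀ hε]
      exact (longGapCount_mul_le hx h0 m).trans hm.2
    · rwa [startCount_succ_of_notMem hm]

/-- The set of first sensors up to `L` is finite, even if the configuration has infinitely many
points in `[0, L]`, because first sensors are more than `ε` apart. -/
theorem exists_encard_startsUpTo_eq (hε : 0 < ε) (hx : StrictMono x) (h0 : 0 < x 0) :
    ∃ M, (∀ m ∈ startsUpTo ε L x, m < M) ∧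
      (startsUpTo ε L x).encard = startCount ε L x M := by
  classical
  have hcard : ∀ t : Finset ℕ, (t : Set ℕ) ⊆ startsUpTo ε L x → t.card ≤ ⌊L / ε⌋₊ + 1 := by
    intro t ht
    refine le_trans ?_ (startCount_le (L := L) hε hx h0 (t.sup id + 1))
    rw [startCount, Finset.card_eq_sum_ones, ← Finset.sum_filter]
    refine Finset.sum_le_sum_of_subset fun m hm => ?_
    rw [Finset.mem_filter, Finset.mem_range, Nat.lt_succ_iff]
    exact ⟨Finset.le_sup (f := id) hm, ht hm⟩
  have hfin : (startsUpTo ε L x).Finite := by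
    by_contra hinf
    obtain ⟨t, ht, hc⟩ := Set.Infinite.exists_subset_card_eq hinf (⌊L / ε⌋₊ + 2)
    have := hcard t ht
    omega
  have hlt : ∀ m ∈ startsUpTo ε L x, m < hfin.toFinset.sup id + 1 := fun m hm =>
    Nat.lt_succ_of_le (Finset.le_sup (f := id) (hfin.mem_toFinset.2 hm))
  refine ⟨_, hlt, ?_⟩
  rw [hfin.encard_eq_coe_toFinset_card, startCount, Finset.card_eq_sum_ones, ← Finset.sum_filter]
  congr 2
  ext m
  simp only [Set.Finite.mem_toFinset, Finset.mem_filter, Finset.mem_range]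
  exact ⟨fun h => ⟨hlt m h, h⟩, fun h => h.2⟩

theorem numIncompleteClusters_le (hε : 0 < ε) (hx : StrictMono x) (h0 : 0 < x 0) :
    numIncompleteClusters ε L x ≤ (⌊L / ε⌋₊ + 1 : ℕ) := by
  obtain ⟨M, -, hM⟩ := exists_encard_startsUpTo_eq (L := L) hε hx h0
  rw [numIncompleteClusters_eq_encard_startsUpTo hx h0, hM]
  exact_mod_cast startCount_le hε hx h0 M

open Classical in
/-- Choosing `k + 1` elements by choosing the largest one first. -/
theorem startCount_choose_succ (k M : ℕ) :
    (startCount ε L x M).choose (k + 1) = ∑ m ∈ Finset.range M,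
      if m ∈ startsUpTo ε L x then (startCount ε L x m).choose k else 0 := by
  induction M with
  | zero => simp [startCount]
  | succ M ih =>
    rw [Finset.sum_range_succ, ← ih]
    split_ifs with h
    · rw [startCount_succ_of_mem h, Nat.choose_succ_succ', add_comm]
    · rw [startCount_succ_of_notMem h, add_zero]

/-- Choosing `k + 1` clusters by first choosing the rightmost one: it starts at sensor number
`0` or right after a long gap, and the other `k` are chosen among the clusters before it. -/
theorem choose_succ_numIncompleteClusters (hε : 0 < ε) (hx : StrictMono x) (h0 : 0 < x 0)
    (k : ℕ) :
    (((numIncompleteClusters ε L x).toNat.choose (k + 1) : ℕ) : ℝ≥0∞) =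
      (if x 0 ≤ L then ((Nat.choose 0 k : ℕ) : ℝ≥0∞) else 0) +
      ∑' m, if ε < x (m + 1) - x m ∧ x (m + 1) ≤ L
        then (((1 + longGapCount ε x m).choose k : ℕ) : ℝ≥0∞) else 0 := by
  classical
  obtain ⟨M, hlt, hM⟩ := exists_encard_startsUpTo_eq (L := L) hε hx h0
  rw [numIncompleteClusters_eq_encard_startsUpTo hx h0, hM, ENat.toNat_natCast,
    startCount_choose_succ, Nat.cast_sum, ← tsum_eq_sum (L := .unconditional ℕ) (s := Finset.range M),
    tsum_eq_zero_add' ENNReal.summable]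
  · congr 1
    · simp [startsUpTo, isClusterStart_zero, startCount]
    · refine tsum_congr fun m => ?_
      by_cases h : ε < x (m + 1) - x m ∧ x (m + 1) ≤ L
      · have hm : m + 1 ∈ startsUpTo ε L x := ⟨(isClusterStart_succ_iff hx m).2 h.1, h.2⟩
        rw [if_pos h, if_pos hm,
          startCount_succ_eq hx ((hx.monotone (Nat.le_succ m)).trans h.2)]
      · have hm : m + 1 ∉ startsUpTo ε L x := fun hm =>
          h ⟨(isClusterStart_succ_iff hx m).1 hm.1, hm.2⟩
        rw [if_neg h, if_neg hm, Nat.cast_zero]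
  · intro m hm
    rw [if_neg fun h => hm (Finset.mem_range.2 (hlt m h)), Nat.cast_zero]

end StrictMono

/-! ### Exponential and Erlang distributions -/

theorem lintegral_expMeasure (r : ℝ) (f : ℝ → ℝ≥0∞) :
    ∫⁻ y, f y ∂(expMeasure r) = ∫⁻ y, exponentialPDF r y * f y := by
  have h : expMeasure r = volume.withDensity (exponentialPDF r) := rfl
  rw [h, lintegral_withDensity_eq_lintegral_mul_non_measurable]
  · rfl
  · exact (measurable_exponentialPDFReal r).ennreal_ofReal
  · exact Filter.Eventually.of_forall fun y => ENNReal.ofReal_lt_top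

theorem ae_expMeasure_pos {r : ℝ} : ∀ᵐ y ∂(expMeasure r), 0 < y := by
  have h : expMeasure r = volume.withDensity (exponentialPDF r) := rfl
  have hm : Measurable (exponentialPDF r) := (measurable_exponentialPDFReal r).ennreal_ofReal
  rw [h, ae_withDensity_iff hm]
  filter_upwards [Measure.ae_ne volume (0 : ℝ)] with y hy hpdf
  by_contra! hle
  exact hpdf (exponentialPDF_of_neg (lt_of_le_of_ne hle hy))

/-- Lack of memory: conditionally on exceeding `ε`, an exponential variable is distributed as its
translate by `ε`. -/
theorem lintegral_expMeasure_indicator_Ioi {r ε : ℝ} (hε : 0 < ε) (f : ℝ → ℝ≥0∞) :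
    ∫⁻ y, (Set.Ioi ε).indicator f y ∂(expMeasure r) =
      ENNReal.ofReal (Real.exp (-(r * ε))) * ∫⁻ y, f (y + ε) ∂(expMeasure r) := by
  rw [lintegral_expMeasure, lintegral_expMeasure, ← lintegral_const_mul' _ _ ENNReal.ofReal_ne_top,
    ← lintegral_add_right_eq_self _ ε]
  refine lintegral_congr_ae ?_
  filter_upwards [Measure.ae_ne volume (0 : ℝ)] with y hy
  rcases lt_or_gt_of_ne hy with h | h
  · rw [exponentialPDF_of_neg h, Set.indicator_of_notMem (by simp [h.le])]
    simp
  · rw [exponentialPDF_of_nonneg h.le, exponentialPDF_of_nonneg (by linarith),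
      Set.indicator_of_mem (by simp [h]), ← mul_assoc, ← ENNReal.ofReal_mul (Real.exp_pos _).le]
    congr 2
    rw [mul_add, neg_add, Real.exp_add]
    ring

/-- The Poisson weight `e⁻ᵃ aʲ / j!`. -/
noncomputable def poissonWeight (a : ℝ) (j : ℕ) : ℝ := Real.exp (-a) * (a ^ j / j.factorial)

theorem poissonWeight_nonneg {a : ℝ} (ha : 0 ≤ a) (j : ℕ) : 0 ≤ poissonWeight a j := by
  unfold poissonWeight; positivity

theorem hasSum_poissonWeight (a : ℝ) : HasSum (poissonWeight a) 1 := by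
  have h := (NormedSpace.expSeries_div_hasSum_exp a).mul_left (Real.exp (-a))
  rw [← Real.exp_eq_exp_ℝ, ← Real.exp_add, neg_add_cancel, Real.exp_zero] at h
  exact h

theorem sum_poissonWeight_le_one {a : ℝ} (ha : 0 ≤ a) (m : ℕ) :
    ∑ j ∈ Finset.range m, poissonWeight a j ≤ 1 :=
  sum_le_hasSum _ (fun j _ => poissonWeight_nonneg ha j) (hasSum_poissonWeight a)

/-- The cumulative distribution function of the sum of `m + 1` independent exponential variables
of parameter `r`: such a sum is at most `a` iff a Poisson process of intensity `r` has more
than `m` points in `[0, a]`. -/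
noncomputable def erlangCDF (r : ℝ) (m : ℕ) (a : ℝ) : ℝ≥0∞ :=
  if 0 ≤ a then ENNReal.ofReal (1 - ∑ j ∈ Finset.range (m + 1), poissonWeight (r * a) j) else 0

/-- A primitive of the exponential density at `y` times the Erlang distribution function
at `a - y`. -/
theorem hasDerivAt_poissonWeight_primitive (r a y : ℝ) (m : ℕ) :
    HasDerivAt (fun y => -Real.exp (-(r * y)) + Real.exp (-(r * a)) *
        ∑ j ∈ Finset.range m, (r * (a - y)) ^ (j + 1) / (j + 1).factorial)
      (r * Real.exp (-(r * y)) * (1 - ∑ j ∈ Finset.range m, poissonWeight (r * (a - y)) j)) y := by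
  have h1 : HasDerivAt (fun y => -Real.exp (-(r * y))) (r * Real.exp (-(r * y))) y :=
    hasDerivAt_neg_exp_mul_exp
  have hlin : HasDerivAt (fun y => r * (a - y)) (-r) y := by
    simpa using ((hasDerivAt_id y).const_sub a).const_mul r
  have h2 : HasDerivAt (fun y => ∑ j ∈ Finset.range m, (r * (a - y)) ^ (j + 1) / (j + 1).factorial)
      (∑ j ∈ Finset.range m, -(r * ((r * (a - y)) ^ j / j.factorial))) y := by
    refine HasDerivAt.fun_sum fun j _ => ?_
    refine ((hlin.fun_pow (j + 1)).div_const _).congr_deriv ?_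
    have hj : ((j : ℝ) + 1) ≠ 0 := by positivity
    have hf : (j.factorial : ℝ) ≠ 0 := by positivity
    rw [Nat.factorial_succ]
    push_cast
    field_simp
  refine (h1.add (h2.const_mul (Real.exp (-(r * a))))).congr_deriv ?_
  have he : Real.exp (-(r * a)) = Real.exp (-(r * y)) * Real.exp (-(r * (a - y))) := by
    rw [← Real.exp_add]; ring_nf
  simp only [poissonWeight]
  rw [he, ← Finset.mul_sum, Finset.sum_neg_distrib, ← Finset.mul_sum]
  ring

theorem expMeasure_Iic {r : ℝ} (hr : 0 < r) (a : ℝ) :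
    expMeasure r (Set.Iic a) = erlangCDF r 0 a := by
  have : IsProbabilityMeasure (expMeasure r) := isProbabilityMeasure_expMeasure hr
  rw [← ofReal_cdf, cdf_expMeasure_eq hr, erlangCDF]
  split_ifs <;> simp [poissonWeight]

/-- Adding an independent exponential variable to an Erlang variable with `m + 1` summands. -/
theorem lintegral_erlangCDF_sub {r : ℝ} (hr : 0 < r) (m : ℕ) (a : ℝ) :
    ∫⁻ y, erlangCDF r m (a - y) ∂(expMeasure r) = erlangCDF r (m + 1) a := by
  rw [lintegral_expMeasure]
  rcases lt_or_ge a 0 with ha | ha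
  · rw [erlangCDF, if_neg ha.not_ge, ← lintegral_zero]
    refine lintegral_congr fun y => ?_
    rcases lt_or_ge y 0 with hy | hy
    · rw [exponentialPDF_of_neg hy, zero_mul]
    · rw [erlangCDF, if_neg (by linarith), mul_zero]
  · set g : ℝ → ℝ := fun y => r * Real.exp (-(r * y)) *
      (1 - ∑ j ∈ Finset.range (m + 1), poissonWeight (r * (a - y)) j) with hg
    have hcont : Continuous g := by
      simp only [hg, poissonWeight]
      fun_prop
    have h1 : ∫⁻ y, exponentialPDF r y * erlangCDF r m (a - y) =
        ∫⁻ y in Set.Icc 0 a, ENNReal.ofReal (g y) := by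
      rw [← lintegral_indicator measurableSet_Icc]
      refine lintegral_congr fun y => ?_
      by_cases hy : y ∈ Set.Icc 0 a
      · rw [Set.indicator_of_mem hy, exponentialPDF_of_nonneg hy.1, erlangCDF,
          if_pos (by linarith [hy.2]), ← ENNReal.ofReal_mul (by positivity)]
      · rw [Set.indicator_of_notMem hy]
        rcases lt_or_ge y 0 with hy0 | hy0
        · rw [exponentialPDF_of_neg hy0, zero_mul]
        · rw [erlangCDF, if_neg, mul_zero]
          intro h
          exact hy ⟨hy0, by linarith⟩
    have hnn : ∀ y ∈ Set.Icc 0 a, 0 ≤ g y := fun y hy =>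
      mul_nonneg (by positivity) (sub_nonneg.2 (sum_poissonWeight_le_one
        (mul_nonneg hr.le (sub_nonneg.2 hy.2)) _))
    rw [h1, ← ofReal_integral_eq_lintegral_ofReal hcont.continuousOn.integrableOn_Icc
      ((ae_restrict_iff' measurableSet_Icc).2 (Filter.Eventually.of_forall hnn)),
      integral_Icc_eq_integral_Ioc, ← intervalIntegral.integral_of_le ha,
      intervalIntegral.integral_eq_sub_of_hasDerivAt
        (fun y _ => hasDerivAt_poissonWeight_primitive r a y (m + 1))
        (hcont.intervalIntegrable 0 a), erlangCDF, if_pos ha]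
    congr 1
    rw [Finset.sum_range_succ' _ (m + 1)]
    simp only [poissonWeight, ← Finset.mul_sum]
    simp
    ring

/-! ### Binomial sums of Poisson weights -/

/-- The binomial moment `E[C(N - 1, k); N ≥ 1]` for a Poisson variable `N` of mean `a`. -/
noncomputable def shiftedBinomialMoment (a : ℝ) (k : ℕ) : ℝ :=
  (-1) ^ k * (∑ j ∈ Finset.range (k + 1), (-a) ^ j / j.factorial - Real.exp (-a))

theorem hasSum_choose_mul_poissonWeight (a : ℝ) (k : ℕ) :
    HasSum (fun r => (r.choose k : ℝ) * poissonWeight a r) (a ^ k / k.factorial) := by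
  rw [← hasSum_nat_add_iff' k, Finset.sum_eq_zero, sub_zero]
  · convert! (hasSum_poissonWeight a).mul_left (a ^ k / k.factorial) using 1
    · ext r
      have h := Nat.add_choose_mul_factorial_mul_factorial r k
      have h' : ((r + k).choose k : ℝ) * r.factorial * k.factorial = (r + k).factorial := by
        exact_mod_cast h
      simp only [poissonWeight]
      have h1 : (r.factorial : ℝ) ≠ 0 := by positivity
      have h2 : (k.factorial : ℝ) ≠ 0 := by positivity
      have h4 : (((r + k).choose k : ℕ) : ℝ) ≠ 0 :=
        Nat.cast_ne_zero.2 (Nat.choose_pos (Nat.le_add_left k r)).ne'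
      rw [← h', pow_add]
      field_simp
    · rw [mul_one]
  · intro r hr
    rw [Nat.choose_eq_zero_of_lt (Finset.mem_range.1 hr), Nat.cast_zero, zero_mul]

/-- By Pascal's rule, consecutive moments `E[C(N - 1, k); N ≥ 1]` add up to the factorial moment
`E[C(N, k + 1)] = a ^ (k + 1) / (k + 1)!`. -/
theorem hasSum_choose_mul_poissonWeight_succ (a : ℝ) (k : ℕ) :
    HasSum (fun r => (r.choose k : ℝ) * poissonWeight a (r + 1)) (shiftedBinomialMoment a k) := by
  induction k with
  | zero =>
    have h := (hasSum_nat_add_iff' 1).2 (hasSum_poissonWeight a)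
    simpa [shiftedBinomialMoment, poissonWeight] using h
  | succ k ih =>
    have h := (hasSum_nat_add_iff' 1).2 (hasSum_choose_mul_poissonWeight a (k + 1))
    convert! h.sub ih using 1
    · ext r
      rw [Nat.choose_succ_succ']
      push_cast
      ring
    · simp only [shiftedBinomialMoment, Finset.sum_range_succ _ (k + 1)]
      simp only [Finset.sum_range_one, Nat.choose_zero_succ, Nat.cast_zero, zero_mul, sub_zero]
      have h1 : ((-1 : ℝ) ^ (k + 1)) * (-a) ^ (k + 1) = a ^ (k + 1) := by
        rw [← mul_pow]; ring
      rw [mul_sub, mul_add, mul_div_assoc', h1]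
      ring

theorem shiftedBinomialMoment_nonneg {a : ℝ} (ha : 0 ≤ a) (k : ℕ) :
    0 ≤ shiftedBinomialMoment a k :=
  (hasSum_choose_mul_poissonWeight_succ a k).nonneg fun _ =>
    mul_nonneg (Nat.cast_nonneg _) (poissonWeight_nonneg ha _)

theorem sum_range_choose_eq_choose_succ (n k : ℕ) :
    ∑ m ∈ Finset.range n, m.choose k = n.choose (k + 1) := by
  induction n with
  | zero => simp
  | succ n ih => rw [Finset.sum_range_succ, ih, Nat.choose_succ_succ', add_comm]

theorem erlangCDF_eq_tsum {r a : ℝ} (hr : 0 < r) (ha : 0 ≤ a) (m : ℕ) :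
    erlangCDF r m a = ∑' j, if m < j then ENNReal.ofReal (poissonWeight (r * a) j) else 0 := by
  have ha' : 0 ≤ r * a := mul_nonneg hr.le ha
  have h := (hasSum_nat_add_iff' (m + 1)).2 (hasSum_poissonWeight (r * a))
  rw [← ENNReal.summable.sum_add_tsum_nat_add' (k := m + 1), Finset.sum_eq_zero, zero_add,
    erlangCDF, if_pos ha, ← h.tsum_eq,
    ENNReal.ofReal_tsum_of_nonneg (fun j => poissonWeight_nonneg ha' _) h.summable]
  · refine tsum_congr fun j => ?_
    rw [if_pos (by omega)]
  · intro j hj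
    rw [if_neg (by have := Finset.mem_range.1 hj; omega)]

/-- Exchanging the order of summation turns the distribution functions `P(N > m + 1)` into the
Poisson weights, by the hockey-stick identity. -/
theorem tsum_choose_mul_erlangCDF {r a : ℝ} (hr : 0 < r) (ha : 0 ≤ a) (k : ℕ) :
    ∑' m : ℕ, (m.choose k : ℝ≥0∞) * erlangCDF r (m + 1) a =
      ENNReal.ofReal (shiftedBinomialMoment (r * a) (k + 1)) := by
  have ha' : 0 ≤ r * a := mul_nonneg hr.le ha
  have h := hasSum_choose_mul_poissonWeight_succ (r * a) (k + 1)
  have hinner : ∀ j : ℕ, (∑' m : ℕ, (m.choose k : ℝ≥0∞) *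
      if m + 1 < j then ENNReal.ofReal (poissonWeight (r * a) j) else 0) =
      ((j - 1).choose (k + 1) : ℕ) * ENNReal.ofReal (poissonWeight (r * a) j) := by
    intro j
    rw [tsum_eq_sum (s := Finset.range (j - 1)), ← sum_range_choose_eq_choose_succ, Nat.cast_sum,
      Finset.sum_mul]
    · refine Finset.sum_congr rfl fun m hm => ?_
      rw [if_pos (by have := Finset.mem_range.1 hm; omega)]
    · intro m hm
      rw [if_neg (by have := mt Finset.mem_range.2 hm; omega), mul_zero]
  simp_rw [erlangCDF_eq_tsum hr ha, ← ENNReal.tsum_mul_left]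
  rw [ENNReal.tsum_comm]
  simp_rw [hinner]
  rw [tsum_eq_zero_add' ENNReal.summable, ← h.tsum_eq,
    ENNReal.ofReal_tsum_of_nonneg
      (fun j => mul_nonneg (Nat.cast_nonneg _) (poissonWeight_nonneg ha' _)) h.summable]
  simp [ENNReal.ofReal_mul]

/-! ### The joint law of a sensor and the number of long gaps before it -/

theorem sum_range_spacing {Ω : Type*} (X : ℕ → Ω → ℝ) (m : ℕ) (ω : Ω) :
    ∑ i ∈ Finset.range (m + 1), spacing X i ω = X m ω := by
  induction m with
  | zero => simp [spacing]
  | succ m ih => rw [Finset.sum_range_succ, ih]; simp [spacing]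

namespace IsPoissonProcess

variable {Ω : Type*} [MeasurableSpace Ω] {μ : Measure Ω} {lam : ℝ} {X : ℕ → Ω → ℝ}

theorem measurable_spacing (hX : IsPoissonProcess μ lam X) (i : ℕ) : Measurable (spacing X i) := by
  cases i with
  | zero => exact hX.measurable 0
  | succ i => exact (hX.measurable (i + 1)).sub (hX.measurable i)

theorem ae_spacing_pos (hX : IsPoissonProcess μ lam X) : ∀ᵐ ω ∂μ, ∀ i, 0 < spacing X i ω := by
  rw [ae_all_iff]
  intro i
  refine ae_of_ae_map (hX.measurable_spacing i).aemeasurable (p := fun y => 0 < y) ?_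
  rw [hX.law i]
  exact ae_expMeasure_pos

theorem ae_strictMono (hX : IsPoissonProcess μ lam X) :
    ∀ᵐ ω ∂μ, StrictMono (fun i => X i ω) ∧ 0 < X 0 ω := by
  filter_upwards [hX.ae_spacing_pos] with ω hω
  exact ⟨strictMono_nat_of_lt_succ fun i => sub_pos.1 (hω (i + 1)), hω 0⟩

theorem measurable_longGapCount (hX : IsPoissonProcess μ lam X) (ε : ℝ) (m : ℕ) :
    Measurable fun ω => longGapCount ε (fun i => X i ω) m :=
  Finset.measurable_fun_sum _ fun l _ => Measurable.ite
    (measurableSet_lt measurable_const ((hX.measurable (l + 1)).sub (hX.measurable l)))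
    measurable_const measurable_const

theorem indepFun_spacing_succ (hX : IsPoissonProcess μ lam X) (ε : ℝ) (m : ℕ) :
    IndepFun (fun ω => (X m ω, longGapCount ε (fun i => X i ω) m)) (spacing X (m + 1)) μ := by
  have h := hX.indep.indepFun_finset (Finset.range (m + 1)) {m + 1} (by simp)
    hX.measurable_spacing
  let g : (Finset.range (m + 1) → ℝ) → ℝ × ℕ := fun e =>
    (∑ i, e i, ∑ i : Finset.range (m + 1), if (i : ℕ) ≠ 0 ∧ ε < e i then 1 else 0)
  have hg : Measurable g := by
    refine Measurable.prodMk (Finset.measurable_fun_sum _ fun i _ => measurable_pi_apply i) ?_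
    refine Finset.measurable_fun_sum _ fun i _ => Measurable.ite ?_ measurable_const measurable_const
    exact (MeasurableSet.const _).inter (measurableSet_lt measurable_const (measurable_pi_apply i))
  have h' := h.comp hg (measurable_pi_apply (⟨m + 1, Finset.mem_singleton_self _⟩ :
    ({m + 1} : Finset ℕ)))
  convert! h' using 1
  ext1 ω
  refine Prod.ext ?_ ?_
  · change X m ω = ∑ i : Finset.range (m + 1), spacing X i ω
    rw [Finset.sum_coe_sort (Finset.range (m + 1)) (fun i => spacing X i ω), sum_range_spacing]
  · change longGapCount ε (fun i => X i ω) m =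
      ∑ i : Finset.range (m + 1), if (i : ℕ) ≠ 0 ∧ ε < spacing X i ω then 1 else 0
    rw [Finset.sum_coe_sort (Finset.range (m + 1))
      (fun i => if i ≠ 0 ∧ ε < spacing X i ω then 1 else 0), Finset.sum_range_succ']
    simp [longGapCount, spacing]

/-- Integration with respect to the spacing after sensor number `m`, which is exponential and
independent of the configuration up to that sensor. -/
theorem lintegral_spacing_succ [IsProbabilityMeasure μ] (hX : IsPoissonProcess μ lam X)
    (ε : ℝ) (m : ℕ) {F : (ℝ × ℕ) × ℝ → ℝ≥0∞} (hF : Measurable F) :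
    ∫⁻ ω, F ((X m ω, longGapCount ε (fun i => X i ω) m), X (m + 1) ω - X m ω) ∂μ =
      ∫⁻ y, ∫⁻ ω, F ((X m ω, longGapCount ε (fun i => X i ω) m), y) ∂μ ∂(expMeasure lam) := by
  have hm := (hX.measurable m).prodMk (hX.measurable_longGapCount ε m)
  have hs := hX.measurable_spacing (m + 1)
  have : IsProbabilityMeasure (μ.map (spacing X (m + 1))) :=
    Measure.isProbabilityMeasure_map hs.aemeasurable
  have : IsProbabilityMeasure
      (μ.map fun ω => (X m ω, longGapCount ε (fun i => X i ω) m)) :=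
    Measure.isProbabilityMeasure_map hm.aemeasurable
  have h := (indepFun_iff_map_prod_eq_prod_map_map hm.aemeasurable hs.aemeasurable).1
    (hX.indepFun_spacing_succ ε m)
  rw [← hX.law (m + 1)]
  calc _ = ∫⁻ p, F p ∂(μ.map fun ω =>
        ((X m ω, longGapCount ε (fun i => X i ω) m), spacing X (m + 1) ω)) :=
        (lintegral_map hF (hm.prodMk hs)).symm
    _ = ∫⁻ y, ∫⁻ q, F (q, y) ∂(μ.map fun ω => (X m ω, longGapCount ε (fun i => X i ω) m))
          ∂(μ.map (spacing X (m + 1))) := by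
        rw [h, lintegral_prod_symm _ hF.aemeasurable]
    _ = _ := by
        refine lintegral_congr fun y => ?_
        exact lintegral_map (hF.comp (measurable_id.prodMk measurable_const)) hm

/-- Up to sensor number `m`, and conditionally on the next spacing being `y`, having
`X (m + 1) ≤ a` means having `X m ≤ a - y`. -/
theorem lintegral_choose_longGapCount_mem [IsProbabilityMeasure μ]
    (hX : IsPoissonProcess μ lam X) (ε : ℝ) (m k : ℕ) (a : ℝ) {B : Set ℝ} (hB : MeasurableSet B)
    [DecidablePred (· ∈ B)] :
    ∫⁻ ω, (if X (m + 1) ω - X m ω ∈ B ∧ X (m + 1) ω ≤ a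
        then ((longGapCount ε (fun i => X i ω) m).choose k : ℝ≥0∞) else 0) ∂μ =
      ∫⁻ y, B.indicator (fun y => ∫⁻ ω, (if X m ω ≤ a - y
        then ((longGapCount ε (fun i => X i ω) m).choose k : ℝ≥0∞) else 0) ∂μ) y
        ∂(expMeasure lam) := by
  have hF : Measurable fun p : (ℝ × ℕ) × ℝ =>
      if p.2 ∈ B ∧ p.1.1 + p.2 ≤ a then (p.1.2.choose k : ℝ≥0∞) else 0 := by
    refine Measurable.ite ?_ ?_ measurable_const
    · exact (hB.preimage measurable_snd).inter
        (measurableSet_le (measurable_fst.fst.add measurable_snd) measurable_const)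
    · exact (measurable_of_countable fun j : ℕ => (j.choose k : ℝ≥0∞)).comp measurable_fst.snd
  have h := hX.lintegral_spacing_succ ε m hF
  simp only [add_sub_cancel] at h
  rw [h]
  refine lintegral_congr fun y => ?_
  by_cases hy : y ∈ B
  · simp only [hy, true_and, Set.indicator_of_mem, le_sub_iff_add_le]
  · simp [hy]

/-- Appending a long gap: the inductive step that deduces the moment with a long gap after sensor
number `m` from the moments at sensor number `m`. -/
theorem lintegral_choose_longGapCount_succ_of [IsProbabilityMeasure μ]
    (hX : IsPoissonProcess μ lam X)
    (hlam : 0 < lam) {ε : ℝ} (hε : 0 < ε) (m k : ℕ) (a : ℝ)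
    (h : ∀ a : ℝ, ∫⁻ ω, (if X m ω ≤ a
        then ((longGapCount ε (fun i => X i ω) m).choose k : ℝ≥0∞) else 0) ∂μ =
      (m.choose k : ℝ≥0∞) * (ENNReal.ofReal (Real.exp (-(lam * ε))) ^ k *
        erlangCDF lam m (a - k * ε))) :
    ∫⁻ ω, (if ε < X (m + 1) ω - X m ω ∧ X (m + 1) ω ≤ a
        then ((longGapCount ε (fun i => X i ω) m).choose k : ℝ≥0∞) else 0) ∂μ =
      (m.choose k : ℝ≥0∞) * (ENNReal.ofReal (Real.exp (-(lam * ε))) ^ (k + 1) *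
        erlangCDF lam (m + 1) (a - (k + 1) * ε)) := by
  have hsplit := hX.lintegral_choose_longGapCount_mem ε m k a (measurableSet_Ioi (a := ε))
  simp only [Set.mem_Ioi] at hsplit
  have harg : ∀ y, a - (y + ε) - k * ε = a - (k + 1) * ε - y := fun y => by ring
  rw [hsplit, lintegral_expMeasure_indicator_Ioi hε]
  simp only [h, harg]
  rw [lintegral_const_mul' _ _ (ENNReal.natCast_ne_top _),
    lintegral_const_mul' _ _ (ENNReal.pow_ne_top ENNReal.ofReal_ne_top),
    lintegral_erlangCDF_sub hlam, pow_succ]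
  ring

/-- `E[C(J, k); X m ≤ a]`, where `J` is the number of gaps longer than `ε` before sensor number
`m`: by lack of memory, prescribing which `k` gaps are long costs a factor `e^{-λε}` each
and shortens the available length by `kε`. -/
theorem lintegral_choose_longGapCount [IsProbabilityMeasure μ] (hX : IsPoissonProcess μ lam X)
    (hlam : 0 < lam) {ε : ℝ} (hε : 0 < ε) (m : ℕ) :
    ∀ (k : ℕ) (a : ℝ),
    ∫⁻ ω, (if X m ω ≤ a then ((longGapCount ε (fun i => X i ω) m).choose k : ℝ≥0∞) else 0) ∂μ =
      (m.choose k : ℝ≥0∞) * (ENNReal.ofReal (Real.exp (-(lam * ε))) ^ k *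
        erlangCDF lam m (a - k * ε)) := by
  induction m with
  | zero =>
    intro k a
    cases k with
    | zero =>
      simp only [longGapCount, Finset.range_zero, Finset.sum_empty, Nat.choose_self, Nat.cast_one,
        pow_zero, one_mul, Nat.cast_zero, zero_mul, sub_zero]
      rw [← expMeasure_Iic hlam, ← hX.law 0,
        Measure.map_apply (hX.measurable_spacing 0) measurableSet_Iic,
        ← lintegral_indicator_one (hX.measurable_spacing 0 measurableSet_Iic)]
      rfl
    | succ k => simp [longGapCount]
  | succ m ih =>
    intro k a
    have h1 : ∀ k : ℕ, ∫⁻ ω, (if X (m + 1) ω ≤ a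
        then ((longGapCount ε (fun i => X i ω) m).choose k : ℝ≥0∞) else 0) ∂μ =
        (m.choose k : ℝ≥0∞) * (ENNReal.ofReal (Real.exp (-(lam * ε))) ^ k *
          erlangCDF lam (m + 1) (a - k * ε)) := by
      intro k
      have h := hX.lintegral_choose_longGapCount_mem ε m k a (B := Set.univ) .univ
      simp only [Set.mem_univ, true_and, Set.indicator_univ, ih] at h
      rw [h, lintegral_const_mul' _ _ (ENNReal.natCast_ne_top _),
        lintegral_const_mul' _ _ (ENNReal.pow_ne_top ENNReal.ofReal_ne_top),
        ← lintegral_erlangCDF_sub hlam]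
      simp only [sub_right_comm]
    cases k with
    | zero => simpa using h1 0
    | succ k =>
      -- The `k + 1` chosen gaps avoid the last one or contain it.
      have h2 : ∀ ω, (if X (m + 1) ω ≤ a
          then ((longGapCount ε (fun i => X i ω) (m + 1)).choose (k + 1) : ℝ≥0∞) else 0) =
          (if X (m + 1) ω ≤ a
            then ((longGapCount ε (fun i => X i ω) m).choose (k + 1) : ℝ≥0∞) else 0) +
          (if ε < X (m + 1) ω - X m ω ∧ X (m + 1) ω ≤ a
            then ((longGapCount ε (fun i => X i ω) m).choose k : ℝ≥0∞) else 0) := by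
        intro ω
        have hs : longGapCount ε (fun i => X i ω) (m + 1) = longGapCount ε (fun i => X i ω) m +
            if ε < X (m + 1) ω - X m ω then 1 else 0 := Finset.sum_range_succ _ _
        rw [hs]
        by_cases hg : ε < X (m + 1) ω - X m ω
        · by_cases ha : X (m + 1) ω ≤ a
          · simp only [hg, ha, if_true, and_self, Nat.choose_succ_succ', Nat.cast_add]
            rw [add_comm]
          · simp [ha]
        · simp [hg]
      simp_rw [h2]
      rw [lintegral_add_left, h1, hX.lintegral_choose_longGapCount_succ_of hlam hε m k a (ih k),
        Nat.choose_succ_succ', Nat.cast_add, Nat.cast_add, Nat.cast_one]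
      · ring
      · exact Measurable.ite (measurableSet_le (hX.measurable (m + 1)) measurable_const)
          ((measurable_of_countable fun j : ℕ => (j.choose (k + 1) : ℝ≥0∞)).comp
            (hX.measurable_longGapCount ε m)) measurable_const

theorem lintegral_choose_longGapCount_succ [IsProbabilityMeasure μ]
    (hX : IsPoissonProcess μ lam X)
    (hlam : 0 < lam) {ε : ℝ} (hε : 0 < ε) (m k : ℕ) (a : ℝ) :
    ∫⁻ ω, (if ε < X (m + 1) ω - X m ω ∧ X (m + 1) ω ≤ a
        then ((longGapCount ε (fun i => X i ω) m).choose k : ℝ≥0∞) else 0) ∂μ =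
      (m.choose k : ℝ≥0∞) * (ENNReal.ofReal (Real.exp (-(lam * ε))) ^ (k + 1) *
        erlangCDF lam (m + 1) (a - (k + 1) * ε)) := by
  exact hX.lintegral_choose_longGapCount_succ_of hlam hε m k a
    (hX.lintegral_choose_longGapCount hlam hε m k)

end IsPoissonProcess

/-! ### Binomial moments of the number of clusters -/

theorem clusterG_natCast_eq (lam ε L : ℝ) (k : ℕ) :
    clusterG lam ε L (k : ℤ) = if k * ε < L then
      Real.exp (-(lam * ε)) ^ k * shiftedBinomialMoment (lam * (L - k * ε)) k else 0 := by
  change (if k * ε < L then _ else (0 : ℝ)) = _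
  refine if_congr Iff.rfl ?_ rfl
  have h1 : Real.exp (-(k * lam * ε)) = Real.exp (-(lam * ε)) ^ k := by
    rw [← Real.exp_nat_mul]; ring_nf
  have h2 : Real.exp (-(lam * L)) =
      Real.exp (-(lam * ε)) ^ k * Real.exp (-(lam * (L - k * ε))) := by
    rw [← h1, ← Real.exp_add]; ring_nf
  have h3 : lam * (k * ε - L) = -(lam * (L - k * ε)) := by ring
  rw [h1, h2, h3, shiftedBinomialMoment]
  ring

theorem clusterG_natCast_nonneg {lam ε L : ℝ} (hlam : 0 < lam) (k : ℕ) :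
    0 ≤ clusterG lam ε L (k : ℤ) := by
  rw [clusterG_natCast_eq]
  split_ifs with h
  · exact mul_nonneg (by positivity)
      (shiftedBinomialMoment_nonneg (mul_nonneg hlam.le (sub_nonneg.2 h.le)) k)
  · exact le_rfl

theorem ofReal_clusterG_zero {lam ε L : ℝ} (hL : 0 < L) :
    ENNReal.ofReal (clusterG lam ε L ((0 : ℕ) : ℤ)) = erlangCDF lam 0 L := by
  rw [clusterG_natCast_eq, erlangCDF, if_pos hL.le, if_pos (by simpa using hL)]
  simp [shiftedBinomialMoment, poissonWeight]

/-- For `k ≥ 1`, `G(k)` is `e^{-kλε}` times a Poisson moment for the mean `λ(L - kε)`; the sum over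
`m` runs over the index of the last of the `k` sensors preceded by a long gap. -/
theorem ofReal_clusterG_succ {lam ε L : ℝ} (hlam : 0 < lam) (k : ℕ) :
    ENNReal.ofReal (clusterG lam ε L ((k + 1 : ℕ) : ℤ)) =
      ∑' m : ℕ, (m.choose k : ℝ≥0∞) * (ENNReal.ofReal (Real.exp (-(lam * ε))) ^ (k + 1) *
        erlangCDF lam (m + 1) (L - (k + 1) * ε)) := by
  rw [tsum_congr fun m => mul_left_comm _ _ _, ENNReal.tsum_mul_left, clusterG_natCast_eq]
  push_cast
  rcases lt_trichotomy ((k + 1) * ε) L with h | h | h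
  · rw [if_pos h, tsum_choose_mul_erlangCDF hlam (sub_nonneg.2 h.le),
      ENNReal.ofReal_mul (by positivity), ENNReal.ofReal_pow (Real.exp_pos _).le]
  · rw [if_neg (by linarith), h, sub_self, tsum_choose_mul_erlangCDF hlam le_rfl, mul_zero]
    have : shiftedBinomialMoment 0 (k + 1) = 0 := by
      simp [shiftedBinomialMoment, Finset.sum_range_succ']
    simp [this]
  · simp [erlangCDF, h.not_gt, h]

namespace IsPoissonProcess

variable {Ω : Type*} [MeasurableSpace Ω] {μ : Measure Ω} {lam : ℝ} {X : ℕ → Ω → ℝ}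

/-- `G(k)` is the expected number of ways to choose `k ≥ 1` sensors in `[0, L]`, each preceded by
a gap longer than `ε`. -/
theorem tsum_lintegral_choose_longGapCount [IsProbabilityMeasure μ]
    (hX : IsPoissonProcess μ lam X)
    (hlam : 0 < lam) {ε : ℝ} (hε : 0 < ε) (L : ℝ) (k : ℕ) :
    ∑' m, ∫⁻ ω, (if ε < X (m + 1) ω - X m ω ∧ X (m + 1) ω ≤ L
        then ((longGapCount ε (fun i => X i ω) m).choose k : ℝ≥0∞) else 0) ∂μ =
      ENNReal.ofReal (clusterG lam ε L ((k + 1 : ℕ) : ℤ)) := by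
  rw [ofReal_clusterG_succ hlam]
  exact tsum_congr fun m => hX.lintegral_choose_longGapCount_succ hlam hε m k L

theorem measurable_ite_choose_longGapCount (hX : IsPoissonProcess μ lam X) (ε L : ℝ) (d m k : ℕ) :
    Measurable fun ω => if ε < X (m + 1) ω - X m ω ∧ X (m + 1) ω ≤ L
      then ((d + longGapCount ε (fun i => X i ω) m).choose k : ℝ≥0∞) else 0 := by
  refine Measurable.ite ?_ ?_ measurable_const
  · exact (measurableSet_lt measurable_const ((hX.measurable (m + 1)).sub (hX.measurable m))).inter
      (measurableSet_le (hX.measurable (m + 1)) measurable_const)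
  · exact (measurable_of_countable fun j : ℕ => ((d + j).choose k : ℝ≥0∞)).comp
      (hX.measurable_longGapCount ε m)

/-- The `i`-th binomial moment of the number of clusters is `G(i - 1) + G(i)`: among the `i`
clusters chosen, the first cluster of all, which is not preceded by a long gap, either occurs
or does not. -/
theorem lintegral_choose_numIncompleteClusters [IsProbabilityMeasure μ]
    (hX : IsPoissonProcess μ lam X)
    (hlam : 0 < lam) {ε L : ℝ} (hε : 0 < ε) (hL : 0 < L) (i : ℕ) :
    ∫⁻ ω, (((numIncompleteClusters ε L (fun j => X j ω)).toNat.choose i : ℕ) : ℝ≥0∞) ∂μ =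
      ENNReal.ofReal (clusterG lam ε L ((i : ℤ) - 1) + clusterG lam ε L (i : ℤ)) := by
  cases i with
  | zero =>
    have h1 : clusterG lam ε L (((0 : ℕ) : ℤ) - 1) = Real.exp (-(lam * L)) := rfl
    rw [h1, clusterG_natCast_eq, if_pos (by simpa using hL)]
    simp [shiftedBinomialMoment]
  | succ k =>
    have hcongr : ∀ᵐ ω ∂μ,
        (((numIncompleteClusters ε L (fun j => X j ω)).toNat.choose (k + 1) : ℕ) : ℝ≥0∞) =
        (if X 0 ω ≤ L then ((Nat.choose 0 k : ℕ) : ℝ≥0∞) else 0) +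
        ∑' m, if ε < X (m + 1) ω - X m ω ∧ X (m + 1) ω ≤ L
          then ((1 + longGapCount ε (fun j => X j ω) m).choose k : ℝ≥0∞) else 0 := by
      filter_upwards [hX.ae_strictMono] with ω hω
      exact choose_succ_numIncompleteClusters hε hω.1 hω.2 k
    have h0 : ∫⁻ ω, (if X 0 ω ≤ L then ((Nat.choose 0 k : ℕ) : ℝ≥0∞) else 0) ∂μ =
        (Nat.choose 0 k : ℕ) * ENNReal.ofReal (clusterG lam ε L ((0 : ℕ) : ℤ)) := by
      have h := hX.lintegral_choose_longGapCount hlam hε 0 k L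
      simp only [longGapCount, Finset.range_zero, Finset.sum_empty] at h
      rw [h, ofReal_clusterG_zero hL]
      cases k <;> simp
    rw [lintegral_congr_ae hcongr, lintegral_add_left (Measurable.ite
      (measurableSet_le (hX.measurable 0) measurable_const) measurable_const measurable_const), h0,
      lintegral_tsum fun m => (hX.measurable_ite_choose_longGapCount ε L 1 m k).aemeasurable,
      show (((k + 1 : ℕ) : ℤ) - 1) = (k : ℤ) by push_cast; ring,
      ENNReal.ofReal_add (clusterG_natCast_nonneg hlam k) (clusterG_natCast_nonneg hlam (k + 1))]
    cases k with
    | zero =>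
      rw [← hX.tsum_lintegral_choose_longGapCount hlam hε]
      simp
    | succ k =>
      -- Pascal's rule splits off the first cluster, which is not preceded by a long gap.
      have hsplit : ∀ m, ∫⁻ ω, (if ε < X (m + 1) ω - X m ω ∧ X (m + 1) ω ≤ L
          then ((1 + longGapCount ε (fun j => X j ω) m).choose (k + 1) : ℝ≥0∞) else 0) ∂μ =
          ∫⁻ ω, (if ε < X (m + 1) ω - X m ω ∧ X (m + 1) ω ≤ L
            then ((longGapCount ε (fun j => X j ω) m).choose k : ℝ≥0∞) else 0) ∂μ +
          ∫⁻ ω, (if ε < X (m + 1) ω - X m ω ∧ X (m + 1) ω ≤ L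
            then ((longGapCount ε (fun j => X j ω) m).choose (k + 1) : ℝ≥0∞) else 0) ∂μ := by
        intro m
        have hmeas := hX.measurable_ite_choose_longGapCount ε L 0 m k
        simp only [zero_add] at hmeas
        rw [← lintegral_add_left hmeas]
        refine lintegral_congr fun ω => ?_
        split_ifs
        · rw [add_comm 1, Nat.choose_succ_succ', Nat.cast_add]
        · rw [add_zero]
      simp_rw [hsplit]
      rw [ENNReal.summable.tsum_add ENNReal.summable,
        hX.tsum_lintegral_choose_longGapCount hlam hε,
        hX.tsum_lintegral_choose_longGapCount hlam hε]
      simp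

end IsPoissonProcess

/-! ### From binomial moments to the distribution -/

/-- Binomial inversion: the indicator of `b = n` as a combination of the binomial coefficients
of `b`. -/
theorem sum_Icc_alternating_choose_mul_choose {b M : ℕ} (hb : b ≤ M) (n : ℕ) :
    ∑ i ∈ Finset.Icc n M, (-1 : ℤ) ^ (i + n) * (i.choose n) * (b.choose i) =
      if b = n then 1 else 0 := by
  rcases lt_or_ge b n with h | h
  · rw [if_neg h.ne, Finset.sum_eq_zero]
    intro i hi
    rw [Nat.choose_eq_zero_of_lt (h.trans_le (Finset.mem_Icc.1 hi).1), Nat.cast_zero, mul_zero]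
  · obtain ⟨d, rfl⟩ := Nat.exists_eq_add_of_le h
    have hsub : Finset.Icc n (n + d) ⊆ Finset.Icc n M := Finset.Icc_subset_Icc_right hb
    rw [← Finset.sum_subset hsub, ← Finset.Ico_add_one_right_eq_Icc, Finset.sum_Ico_eq_sum_range,
      show n + d + 1 - n = d + 1 by omega]
    · have hterm : ∀ j ∈ Finset.range (d + 1),
          (-1 : ℤ) ^ (n + j + n) * ((n + j).choose n) * ((n + d).choose (n + j)) =
          ((n + d).choose n) * ((-1) ^ j * (d.choose j)) := by
        intro j hj
        have hm := Nat.choose_mul (n := n + d) (k := n + j) (s := n) (Nat.le_add_right n j)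
        simp only [Nat.add_sub_cancel_left] at hm
        have hs : (-1 : ℤ) ^ (n + j + n) = (-1) ^ j := by
          rw [show n + j + n = 2 * n + j by ring, pow_add, pow_mul]
          simp
        have hm' : ((n + d).choose (n + j) : ℤ) * ((n + j).choose n) =
            ((n + d).choose n) * (d.choose j) := by exact_mod_cast hm
        rw [hs]
        linear_combination (-1) ^ j * hm'
      rw [Finset.sum_congr rfl hterm, ← Finset.mul_sum, Int.alternating_sum_range_choose]
      by_cases hd : d = 0 <;> simp [hd]
    · intro i hi hi'
      simp only [Finset.mem_Icc, not_and, not_le] at hi hi'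
      rw [Nat.choose_eq_zero_of_lt (hi' hi.1), Nat.cast_zero, mul_zero]

theorem measurable_toNat_numIncompleteClusters {Ω : Type*} [MeasurableSpace Ω] {X : ℕ → Ω → ℝ}
    (hX : ∀ i, Measurable (X i)) (ε L : ℝ) :
    Measurable fun ω => (numIncompleteClusters ε L (fun i => X i ω)).toNat := by
  have hpos : ∀ n, MeasurableSet
      {ω | (numIncompleteClusters ε L (fun i => X i ω)).toNat = n + 1} := by
    intro n
    convert! measurableSet_numIncompleteClusters_eq hX ε L (n + 1) using 1
    ext ω
    exact ENat.toNat_eq_iff n.succ_ne_zero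
  refine measurable_to_countable' fun n => ?_
  cases n with
  | zero =>
    convert! (MeasurableSet.iUnion hpos).compl using 1
    ext ω
    simp only [Set.mem_preimage, Set.mem_singleton_iff, Set.mem_compl_iff, Set.mem_iUnion]
    exact ⟨fun h ⟨n, hn⟩ => n.succ_ne_zero (hn.symm.trans h), fun h => by
      by_contra h0
      obtain ⟨n, hn⟩ := Nat.exists_eq_succ_of_ne_zero h0
      exact h ⟨n, hn⟩⟩
  | succ n => exact hpos n

theorem mainTheorem6 {Ω : Type*} [MeasurableSpace Ω] (μ : Measure Ω) [IsProbabilityMeasure μ]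
    (lam ε L : ℝ) (hlam : 0 < lam) (hε : 0 < ε) (hL : 0 < L)
    (X : ℕ → Ω → ℝ) (hX : IsPoissonProcess μ lam X) (n : ℕ) :
    MeasurableSet {ω | numIncompleteClusters ε L (fun i => X i ω) = (n : ℕ∞)} ∧
    μ.real {ω | numIncompleteClusters ε L (fun i => X i ω) = (n : ℕ∞)} =
      ∑ i ∈ Finset.Icc n (⌊L / ε⌋₊ + 1),
        (-1 : ℝ) ^ (i + n) * (i.choose n : ℝ) *
          (clusterG lam ε L ((i : ℤ) - 1) + clusterG lam ε L (i : ℤ)) := by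
  have hms := measurableSet_numIncompleteClusters_eq hX.measurable ε L n
  refine ⟨hms, ?_⟩
  set N : Ω → ℕ∞ := fun ω => numIncompleteClusters ε L (fun i => X i ω) with hN
  have hbound : ∀ᵐ ω ∂μ, N ω = ((N ω).toNat : ℕ∞) ∧ (N ω).toNat ≤ ⌊L / ε⌋₊ + 1 := by
    filter_upwards [hX.ae_strictMono] with ω hω
    have hle : N ω ≤ (⌊L / ε⌋₊ + 1 : ℕ) := numIncompleteClusters_le hε hω.1 hω.2
    have hcoe := ENat.natCast_toNat (ne_top_of_le_ne_top (ENat.natCast_ne_top _) hle)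
    refine ⟨hcoe.symm, ?_⟩
    rw [← hcoe] at hle
    exact_mod_cast hle
  have hmeas : ∀ i, Measurable fun ω => ((N ω).toNat.choose i : ℝ) := fun i =>
    (measurable_of_countable fun j : ℕ => (j.choose i : ℝ)).comp
      (measurable_toNat_numIncompleteClusters hX.measurable ε L)
  have hlint : ∀ i, ∫⁻ ω, ENNReal.ofReal ((N ω).toNat.choose i : ℝ) ∂μ =
      ENNReal.ofReal (clusterG lam ε L ((i : ℤ) - 1) + clusterG lam ε L (i : ℤ)) := by
    intro i
    simp_rw [ENNReal.ofReal_natCast]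
    exact hX.lintegral_choose_numIncompleteClusters hlam hε hL i
  have hnn : ∀ i : ℕ, 0 ≤ clusterG lam ε L ((i : ℤ) - 1) + clusterG lam ε L (i : ℤ) := by
    intro i
    refine add_nonneg ?_ (clusterG_natCast_nonneg hlam i)
    cases i with
    | zero => exact (Real.exp_pos _).le
    | succ k =>
      rw [show (((k + 1 : ℕ) : ℤ) - 1) = (k : ℤ) by push_cast; ring]
      exact clusterG_natCast_nonneg hlam k
  have hint : ∀ i, Integrable (fun ω => ((N ω).toNat.choose i : ℝ)) μ := by
    intro i
    refine ⟨(hmeas i).aestronglyMeasurable, ?_⟩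
    rw [hasFiniteIntegral_iff_ofReal (Filter.Eventually.of_forall fun ω => Nat.cast_nonneg _),
      hlint]
    exact ENNReal.ofReal_lt_top
  have hmoment : ∀ i, ∫ ω, ((N ω).toNat.choose i : ℝ) ∂μ =
      clusterG lam ε L ((i : ℤ) - 1) + clusterG lam ε L (i : ℤ) := by
    intro i
    rw [integral_eq_lintegral_of_nonneg_ae (Filter.Eventually.of_forall fun ω => Nat.cast_nonneg _)
      (hmeas i).aestronglyMeasurable, hlint, ENNReal.toReal_ofReal (hnn i)]
  have hind : {ω | N ω = n}.indicator 1 =ᵐ[μ] fun ω => ∑ i ∈ Finset.Icc n (⌊L / ε⌋₊ + 1),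
      (-1 : ℝ) ^ (i + n) * (i.choose n : ℝ) * ((N ω).toNat.choose i : ℝ) := by
    filter_upwards [hbound] with ω hω
    have h : ((if (N ω).toNat = n then 1 else 0 : ℤ) : ℝ) = _ :=
      congrArg Int.cast (sum_Icc_alternating_choose_mul_choose hω.2 n).symm
    push_cast at h
    rw [← h, Set.indicator_apply]
    refine if_congr ?_ rfl rfl
    rw [Set.mem_ofPred_eq, hω.1, ENat.toNat_natCast, Nat.cast_inj]
  rw [← integral_indicator_one hms, integral_congr_ae hind,
    integral_finsetSum _ fun i _ => (hint i).const_mul _]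
  exact Finset.sum_congr rfl fun i _ => by rw [integral_const_mul, hmoment]
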